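/- **Proposition.** For an integer $k\ge 1$, the class of $k$-trees is defined recursively: a $k$-tree is either a complete graph on $k$ vertices or a graph obtained from a smaller $k$-tree by adjoining a new vertex together with $k$ edges connecting it to the vertices of a $k$-clique. Let $K_{n,k}$ denote the number of unlabeled $k$-trees (that is, isomorphism classes of $k$-trees) with $n+k$ vertices. Then for every integer $n\ge 4$, $$K_{n,n-2}-K_{n,n-3}=K_{n-1,1},$$ and $K_{n-1,1}$ is the number of unlabeled (ordinary) trees with $n$ vertices. In other words, the number of unlabeled $(n-2)$-trees with $2n-2$ vertices minus the number of unlabeled $(n-3)$-trees with $2n-3$ vertices equals the number of unlabeled trees with $n$ vertices. -/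

import Mathlib

universe u

/-- The class of `k`-trees, defined recursively: a `k`-tree is either a complete graph on `k`
vertices, or a graph `G` obtained from a smaller `k`-tree (here `G` with the vertex `v` deleted)
by adjoining a new vertex `v` whose neighbours are exactly the vertices of a `k`-clique. -/
inductive IsKTree (k : ℕ) : {V : Type u} → SimpleGraph V → Prop
  | complete {V : Type u} (e : Nonempty (V ≃ Fin k)) : IsKTree k (⊤ : SimpleGraph V)
  | adjoin {V : Type u} (G : SimpleGraph V) (v : V)
      (smaller : IsKTree k (G.induce {w : V | w ≠ v}))
      (clique : G.IsClique (G.neighborSet v))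
      (card : (G.neighborSet v).encard = k) : IsKTree k G

/-- Isomorphism of graphs on the vertex set `Fin m` that have the property `P`. -/
def graphIsoSetoid {m : ℕ} (P : SimpleGraph (Fin m) → Prop) :
    Setoid {G : SimpleGraph (Fin m) // P G} where
  r G H := Nonempty (G.1 ≃g H.1)
  iseqv := ⟨fun _ => ⟨SimpleGraph.Iso.refl⟩, fun ⟨f⟩ => ⟨f.symm⟩, fun ⟨f⟩ ⟨g⟩ => ⟨g.comp f⟩⟩

/-- The number of unlabeled graphs (isomorphism classes of graphs) with `m` vertices that have
the property `P`. -/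
noncomputable def unlabeledCount (m : ℕ) (P : SimpleGraph (Fin m) → Prop) : ℕ :=
  Nat.card (Quotient (graphIsoSetoid P))

/-- The number `K_{n,k}` of unlabeled `k`-trees with `n + k` vertices. -/
noncomputable def kTreeCount (n k : ℕ) : ℕ :=
  unlabeledCount (n + k) (fun G => IsKTree k G)

/-- The number of unlabeled (ordinary) trees with `n` vertices. -/
noncomputable def treeCount (n : ℕ) : ℕ :=
  unlabeledCount n (fun G => G.IsTree)

/-! Put `k = n - 2`; the `k`-trees to be counted have `2 * k + 2` vertices. Those with a universal
vertex are the cones over `(k - 1)`-trees (`isKTree_cone_iff`), and a cone determines its base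
(`nonempty_iso_of_cone`), so they account for `K_{n,n-3}`.

The others correspond to trees `T` with `n` vertices. Each edge cuts `T` into two halves; join two
of the `2 * (n - 1)` halves when they meet. Adding a leaf at `c` to `T` adds to this graph an apex
(the complement of the leaf) and a vertex (the leaf itself) joined to the halves through `c`
(`IsHalfGraph.attach`). Conversely, a `k`-tree of this size without universal vertices always
decomposes in this way (`exists_iso_attach_cone`), so induction produces its tree. The tree is
recovered from the graph because its vertices are the maximum cliques (`eq_star`,
`nonempty_iso_tree`). -/

namespace SimpleGraph

/-! ### Attaching vertices and coning. -/

variable {V W : Type*}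

/-- The graph obtained from `G` by adding one new vertex, adjacent to the vertices in `C`. -/
def attach (G : SimpleGraph V) (C : Set V) : SimpleGraph (Option V) where
  Adj x y := match x, y with
    | some a, some b => G.Adj a b
    | none, some b => b ∈ C
    | some a, none => a ∈ C
    | none, none => False
  symm := ⟨by rintro (_ | a) (_ | b) h <;> first | exact h | exact SimpleGraph.Adj.symm h⟩
  loopless := ⟨by rintro (_ | a) h <;> first | exact h | exact G.loopless.irrefl _ h⟩

section attach

variable (G : SimpleGraph V) (C : Set V)

@[simp] theorem attach_some_some (a b : V) : (G.attach C).Adj (some a) (some b) ↔ G.Adj a b :=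
  Iff.rfl

@[simp] theorem attach_none_some (b : V) : (G.attach C).Adj none (some b) ↔ b ∈ C := Iff.rfl

@[simp] theorem attach_some_none (a : V) : (G.attach C).Adj (some a) none ↔ a ∈ C := Iff.rfl

end attach

/-- The graph obtained from `G` by adding one new vertex, adjacent to all others. -/
abbrev cone (G : SimpleGraph V) : SimpleGraph (Option V) := G.attach Set.univ

theorem isUniversal_none_cone (G : SimpleGraph V) : G.cone.IsUniversal none := by
  rintro (_ | w) hw
  · exact absurd rfl hw
  · simp

theorem IsUniversal.map {G : SimpleGraph V} {H : SimpleGraph W} {u : V} (h : G.IsUniversal u)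
    (e : G ≃g H) : H.IsUniversal (e u) := by
  intro w hw
  rw [← e.apply_symm_apply w, e.map_adj_iff]
  exact h fun h => hw (by rw [h, e.apply_symm_apply])

/-- Attaching vertices to isomorphic graphs along corresponding sets. -/
def attachCongr {G : SimpleGraph V} {H : SimpleGraph W} {C : Set V} {D : Set W} (e : G ≃g H)
    (h : ∀ v, v ∈ C ↔ e v ∈ D) : G.attach C ≃g H.attach D where
  toEquiv := e.toEquiv.optionCongr
  map_rel_iff' := by
    rintro (_ | a) (_ | b)
    · exact Iff.rfl
    · exact (h b).symm
    · exact (h a).symm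
    · exact e.map_adj_iff

def coneCongr {G : SimpleGraph V} {H : SimpleGraph W} (e : G ≃g H) : G.cone ≃g H.cone :=
  attachCongr e (by simp)

open Classical in
/-- A graph is obtained from a vertex-deleted subgraph by attaching the deleted vertex. -/
noncomputable def attachInduce (G : SimpleGraph V) (v : V) :
    (G.induce {w | w ≠ v}).attach {w | G.Adj v w} ≃g G where
  toEquiv := Equiv.optionSubtypeNe v
  map_rel_iff' := by
    rintro (_ | a) (_ | b)
    · simp
    · exact Iff.rfl
    · exact G.adj_comm _ _
    · exact Iff.rfl

/-- Deleting the attached vertex. -/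
def attachInduceNone (G : SimpleGraph V) (C : Set V) :
    G ≃g (G.attach C).induce {w | w ≠ none} where
  toFun v := ⟨some v, by simp⟩
  invFun w := w.1.get (Option.isSome_iff_ne_none.2 w.2)
  left_inv v := by simp
  right_inv w := by simp
  map_rel_iff' := Iff.rfl

/-- Attaching a vertex commutes with coning. -/
def coneAttach (G : SimpleGraph V) (C : Set V) :
    G.cone.attach (insert none (some '' C)) ≃g (G.attach C).cone where
  toFun
    | none => some none
    | some none => none
    | some (some a) => some (some a)
  invFun
    | none => some none
    | some none => none
    | some (some a) => some (some a)
  left_inv := by rintro (_ | _ | a) <;> rfl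
  right_inv := by rintro (_ | _ | a) <;> rfl
  map_rel_iff' := by
    rintro (_ | _ | a) (_ | _ | b) <;> simp

def induceCongr {G : SimpleGraph V} {H : SimpleGraph W} (e : G ≃g H) (v : V) :
    G.induce {w | w ≠ v} ≃g H.induce {w | w ≠ e v} where
  toEquiv := e.toEquiv.subtypeEquiv fun a => by simp
  map_rel_iff' := e.map_adj_iff

def induceInduceComm (G : SimpleGraph V) (u v : V) (h : u ≠ v) :
    (G.induce {w | w ≠ v}).induce {w | w ≠ ⟨u, h⟩} ≃g
      (G.induce {w | w ≠ u}).induce {w | w ≠ ⟨v, h.symm⟩} where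
  toFun w := ⟨⟨w.1.1, fun hw => w.2 (Subtype.ext hw)⟩, fun hw => w.1.2 (congrArg Subtype.val hw)⟩
  invFun w := ⟨⟨w.1.1, fun hw => w.2 (Subtype.ext hw)⟩, fun hw => w.1.2 (congrArg Subtype.val hw)⟩
  left_inv _ := rfl
  right_inv _ := rfl
  map_rel_iff' := Iff.rfl

theorem eq_top_of_iso {G : SimpleGraph V} (e : (⊤ : SimpleGraph W) ≃g G) : G = ⊤ := by
  ext a b
  rw [← e.symm.map_adj_iff]
  simp

theorem eq_top_iff_isUniversal {G : SimpleGraph V} : G = ⊤ ↔ ∀ u, G.IsUniversal u := by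
  constructor
  · rintro rfl u w hw
    exact hw
  · intro h
    ext a b
    exact ⟨fun h => h.ne, fun hab => h a hab⟩

open Classical in
/-- Cones over two graphs are isomorphic only if the graphs are. -/
theorem nonempty_iso_of_cone {G : SimpleGraph V} {H : SimpleGraph W} (e : G.cone ≃g H.cone) :
    Nonempty (G ≃g H) := by
  refine ⟨⟨Equiv.removeNone e.toEquiv, ?_⟩⟩
  -- If `e` sends `some a` to the apex, then `a` is universal in `G`, and `removeNone` reroutes it
  -- to `e none`, which is universal as the image of an apex.
  have key : ∀ a b, e (some a) = none → a ≠ b →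
      H.Adj (Equiv.removeNone e.toEquiv a) (Equiv.removeNone e.toEquiv b) ∧ G.Adj a b := by
    intro a b ha hab
    have h1 : some (Equiv.removeNone e.toEquiv a) = e none := Equiv.removeNone_none _ ha
    have hb : ∃ x', e.toEquiv (some b) = some x' := by
      rw [← Option.ne_none_iff_exists']
      intro hb
      exact hab (Option.some_injective _ (e.injective (ha.trans hb.symm)))
    have h2 : some (Equiv.removeNone e.toEquiv b) = e (some b) := Equiv.removeNone_some _ hb
    constructor
    · rw [← attach_some_some H Set.univ, h1, h2, e.map_adj_iff]
      simp
    · rw [← attach_some_some G Set.univ, ← e.map_adj_iff, ha, ← h2]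
      simp
  intro a b
  by_cases hab : a = b
  · simp [hab]
  by_cases ha : e (some a) = none
  · exact iff_of_true (key a b ha hab).1 (key a b ha hab).2
  by_cases hb : e (some b) = none
  · exact iff_of_true (key b a hb (Ne.symm hab)).1.symm (key b a hb (Ne.symm hab)).2.symm
  have h1 : some (Equiv.removeNone e.toEquiv a) = e (some a) :=
    Equiv.removeNone_some _ (Option.ne_none_iff_exists'.1 ha)
  have h2 : some (Equiv.removeNone e.toEquiv b) = e (some b) :=
    Equiv.removeNone_some _ (Option.ne_none_iff_exists'.1 hb)
  rw [← attach_some_some H Set.univ, h1, h2, e.map_adj_iff, attach_some_some]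

end SimpleGraph

theorem Set.encard_of_none_mem {α : Type*} {s : Set (Option α)} (h : none ∈ s) :
    s.encard = (some ⁻¹' s).encard + 1 := by
  have : s = insert none (some '' (some ⁻¹' s)) := by
    ext (_ | x) <;> simp [h]
  rw [this, Set.encard_insert_of_notMem (by simp), (Option.some_injective α).encard_image]
  congr 2
  ext x
  simp

theorem Set.encard_of_none_notMem {α : Type*} {s : Set (Option α)} (h : none ∉ s) :
    s.encard = (some ⁻¹' s).encard := by
  have : s = some '' (some ⁻¹' s) := by
    ext (_ | x) <;> simp [h]
  conv_lhs => rw [this, (Option.some_injective α).encard_image]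

/-! ### Cliques and cones of `k`-trees. -/

namespace IsKTree

open SimpleGraph

variable {k : ℕ}

theorem of_iso {V W : Type*} {G : SimpleGraph V} {H : SimpleGraph W} (h : IsKTree k G)
    (e : G ≃g H) : IsKTree k H := by
  induction h generalizing W with
  | complete f =>
    obtain rfl := eq_top_of_iso e
    exact complete (f.map fun f => e.toEquiv.symm.trans f)
  | adjoin G v _ clique card ih =>
    have hN : H.neighborSet (e v) = e '' G.neighborSet v := by
      ext w
      constructor
      · intro hw
        exact ⟨e.symm w, e.map_adj_iff.1 (by simpa using hw), by simp⟩
      · rintro ⟨x, hx, rfl⟩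
        exact e.map_adj_iff.2 hx
    refine adjoin H (e v) (ih (induceCongr e v)) ?_ ?_
    · rw [hN]
      rintro _ ⟨a, ha, rfl⟩ _ ⟨b, hb, rfl⟩ hab
      exact e.map_adj_iff.2 (clique ha hb fun h => hab (by rw [h]))
    · rw [hN, e.injective.encard_image, card]

theorem attach {V : Type*} {G : SimpleGraph V} (h : IsKTree k G) {C : Set V} (hC : G.IsClique C)
    (hk : C.encard = k) : IsKTree k (G.attach C) := by
  have hN : (G.attach C).neighborSet none = some '' C := by
    ext (_ | w) <;> simp
  refine adjoin _ none (h.of_iso (attachInduceNone G C)) ?_ ?_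
  · rw [hN]
    rintro _ ⟨a, ha, rfl⟩ _ ⟨b, hb, rfl⟩ hab
    exact hC ha hb fun h => hab (by rw [h])
  · rw [hN, (Option.some_injective V).encard_image, hk]

/-- Induction on `k`-trees up to isomorphism. -/
theorem iso_induction {P : ∀ {V : Type}, SimpleGraph V → Prop}
    (iso : ∀ {V W : Type} {G : SimpleGraph V} {H : SimpleGraph W}, (G ≃g H) → P G → P H)
    (complete : P (⊤ : SimpleGraph (Fin k)))
    (attach : ∀ {V : Type} (G : SimpleGraph V) (C : Set V), IsKTree k G → P G → G.IsClique C →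
      C.encard = k → P (G.attach C))
    {V : Type} {G : SimpleGraph V} (h : IsKTree k G) : P G := by
  induction h with
  | complete f => exact iso (Iso.completeGraph f.some.symm) complete
  | adjoin G v smaller clique card ih =>
    refine iso (attachInduce G v) (attach _ _ smaller ih ?_ ?_)
    · intro a ha b hb hab
      exact clique ha hb fun h => hab (Subtype.ext h)
    · rw [← card, ← Subtype.val_injective.encard_image]
      congr 1
      ext w
      simp only [Set.mem_image, Set.mem_ofPred_eq, mem_neighborSet]
      exact ⟨by rintro ⟨x, hx, rfl⟩; exact hx, fun h => ⟨⟨w, h.ne'⟩, h, rfl⟩⟩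

theorem finite {V : Type} {G : SimpleGraph V} (h : IsKTree k G) : Finite V :=
  h.iso_induction (P := fun {V} _ => Finite V) (fun e _ => Finite.of_equiv _ e.toEquiv)
    inferInstance (fun _ _ _ _ _ _ => inferInstance)

/-- A clique through the newly attached vertex has all its other members in the `k`-clique `C`. -/
theorem encard_clique_le {V : Type} {G : SimpleGraph V} (h : IsKTree k G) :
    ∀ s : Set V, G.IsClique s → s.encard ≤ k + 1 := by
  refine h.iso_induction (P := fun {V} G => ∀ s : Set V, G.IsClique s → s.encard ≤ k + 1)
    ?_ ?_ ?_
  · intro V W G H e ih s hs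
    rw [← Set.encard_preimage_of_bijective e.bijective]
    exact ih _ fun a ha b hb hab => e.map_adj_iff.1 (hs ha hb fun h => hab (e.injective h))
  · intro s _
    refine (Set.encard_le_card).trans ?_
    simp
  · intro V G C _ ih _ hC s hs
    by_cases h0 : none ∈ s
    · rw [Set.encard_of_none_mem h0, ← hC]
      gcongr
      intro x hx
      exact hs h0 hx (by simp)
    · rw [Set.encard_of_none_notMem h0]
      exact ih _ fun a ha b hb hab => hs ha hb (by simpa using hab)

theorem complete_succ {V : Type*} (e : Nonempty (V ≃ Fin (k + 1))) :
    IsKTree k (⊤ : SimpleGraph V) := by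
  obtain ⟨e⟩ := e
  let v := e.symm 0
  have hc : ∀ s : Set V, (⊤ : SimpleGraph V).IsClique s := fun s a _ b _ h => h
  have hN : ((⊤ : SimpleGraph V).neighborSet v) = {w | w ≠ v} := by
    ext w
    simp
  have hcard : ({w | w ≠ v} : Set V).encard = k := by
    have : ({w | w ≠ v} : Set V) = {v}ᶜ := rfl
    have h2 := Set.encard_add_encard_compl ({v} : Set V)
    rw [Set.encard_univ, ENat.card_congr e, Set.encard_singleton, ← this] at h2
    simp only [ENat.card_eq_coe_fintype_card, Fintype.card_fin, Nat.cast_add, Nat.cast_one] at h2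
    rw [add_comm] at h2
    exact ENat.add_left_injective_of_ne_top (ENat.natCast_ne_top 1) h2
  refine adjoin _ v ?_ (hc _) (by rw [hN, hcard])
  have : ((⊤ : SimpleGraph V).induce {w | w ≠ v}) = ⊤ := by
    ext a b
    simp [Subtype.ext_iff]
  rw [this]
  refine complete ?_
  have hf : Finite V := Finite.of_equiv _ e.symm
  refine ⟨Finite.equivFinOfCardEq ?_⟩
  rw [Nat.card_coe_set_eq, Set.ncard, hcard]
  simp

theorem cone {V : Type} {G : SimpleGraph V} (h : IsKTree k G) : IsKTree (k + 1) G.cone := by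
  refine h.iso_induction (P := fun {V} G => IsKTree (k + 1) G.cone) ?_ ?_ ?_
  · intro V W G H e h
    exact h.of_iso (coneCongr e)
  · have : (⊤ : SimpleGraph (Fin k)).cone = ⊤ := by
      ext (_ | a) (_ | b) <;> simp
    rw [this]
    exact complete ⟨(finSuccEquiv k).symm⟩
  · intro V G C _ ih hC hk
    refine (ih.attach (C := insert none (some '' C)) ?_ ?_).of_iso (coneAttach G C)
    · rintro (_ | a) ha (_ | b) hb hab
      · exact absurd rfl hab
      · simp
      · simp
      · exact hC (by simpa using ha) (by simpa using hb) (by simpa using hab)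
    · rw [Set.encard_insert_of_notMem (by simp), (Option.some_injective V).encard_image, hk]
      simp

/-- The same construction sequence works after dropping `u`: each later vertex `v` is adjacent to
`u`, so its neighbourhood shrinks from `k + 1` to `k`. -/
theorem induce_of_isUniversal {j : ℕ} {V : Type*} {G : SimpleGraph V} (h : IsKTree j G)
    (hj : j = k + 1) (u : V) (hu : G.IsUniversal u) : IsKTree k (G.induce {w | w ≠ u}) := by
  induction h with
  | @complete V e =>
    subst hj
    obtain ⟨e⟩ := e
    have h1 : ((⊤ : SimpleGraph V).induce {w | w ≠ u}) = ⊤ := by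
      ext a b
      simp [Subtype.ext_iff]
    have hf : Finite V := Finite.of_equiv _ e.symm
    rw [h1]
    refine complete ⟨Finite.equivFinOfCardEq ?_⟩
    have : ({w | w ≠ u} : Set V) = {u}ᶜ := rfl
    rw [this, Nat.card_coe_set_eq, Set.ncard_compl, Nat.card_congr e]
    simp
  | @adjoin V G v smaller clique card ih =>
    subst hj
    -- If the universal vertex is the last one adjoined, all other vertices form its `(k +
    -- 1)`-clique, so what remains is complete.
    by_cases hv : u = v
    · subst hv
      have hN : G.neighborSet u = {w | w ≠ u} := by
        ext w
        exact ⟨fun h => h.ne', fun h => hu (Ne.symm h)⟩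
      have h1 : G.induce {w | w ≠ u} = ⊤ := by
        ext a b
        refine ⟨fun h => h.ne, fun h => ?_⟩
        rw [hN] at clique
        exact clique a.2 b.2 fun h' => h (Subtype.ext h')
      rw [h1]
      rw [hN] at card
      have : Finite ({w | w ≠ u} : Set V) := Set.finite_of_encard_eq_coe card
      refine complete_succ ⟨Finite.equivFinOfCardEq ?_⟩
      rw [Nat.card_coe_set_eq, Set.ncard, card]
      simp
    · have hvu : v ≠ u := Ne.symm hv
      have hS : IsKTree k _ := ih ⟨u, hv⟩ fun w hw => hu fun h => hw (Subtype.ext h)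
      refine adjoin _ ⟨v, hvu⟩ (hS.of_iso (induceInduceComm G u v hv)) ?_ ?_
      · intro a ha b hb hab
        exact clique ha hb fun h => hab (Subtype.ext h)
      · have hmem : u ∈ G.neighborSet v := (hu hv).symm
        have h2 := Set.encard_sdiff_singleton_add_one hmem
        rw [card, Nat.cast_add, Nat.cast_one] at h2
        rw [← Subtype.val_injective.encard_image]
        refine Eq.trans ?_ (ENat.add_left_injective_of_ne_top (ENat.natCast_ne_top 1) h2)
        congr 1
        ext w
        simp only [Set.mem_image, mem_neighborSet, Set.mem_sdiff, Set.mem_singleton_iff]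
        exact ⟨by rintro ⟨x, hx, rfl⟩; exact ⟨hx, x.2⟩, fun h => ⟨⟨w, h.2⟩, h.1, rfl⟩⟩

end IsKTree

theorem isKTree_cone_iff {k : ℕ} {V : Type} {G : SimpleGraph V} :
    IsKTree (k + 1) G.cone ↔ IsKTree k G :=
  ⟨fun h => (h.induce_of_isUniversal rfl none G.isUniversal_none_cone).of_iso
    (SimpleGraph.attachInduceNone G Set.univ).symm, IsKTree.cone⟩

/-! ### Universal vertices in `k`-trees with few vertices. -/

namespace SimpleGraph

variable {V : Type*} {G : SimpleGraph V}

theorem IsClique.union_universalVerts {C : Set V} (hC : G.IsClique C) :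
    G.IsClique (C ∪ G.universalVerts) := by
  rintro a (ha | ha) b (hb | hb) hab
  · exact hC ha hb hab
  · exact (hb hab.symm).symm
  · exact ha hab
  · exact ha hab

theorem isUniversal_some_attach {C : Set V} {u : V} :
    (G.attach C).IsUniversal (some u) ↔ G.IsUniversal u ∧ u ∈ C := by
  constructor
  · intro h
    exact ⟨fun w hw => h (w := some w) (by simpa using hw), h (w := none) (by simp)⟩
  · rintro ⟨h, hu⟩ (_ | w) hw
    · exact hu
    · exact h (by simpa using hw)

theorem isUniversal_none_attach {C : Set V} :
    (G.attach C).IsUniversal none ↔ ∀ v, v ∈ C := by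
  constructor
  · intro h v
    exact h (w := some v) (by simp)
  · rintro h (_ | w) hw
    · exact absurd rfl hw
    · exact h w

end SimpleGraph

namespace IsKTree

open SimpleGraph

variable {k : ℕ}

/-- A `k`-tree with `m + 1` cliques of size `k + 1` has at least `k + 1 - m` universal vertices. -/
theorem le_ncard_universalVerts {V : Type} {G : SimpleGraph V} (h : IsKTree k G) :
    (Nat.card V = k ∧ G = ⊤) ∨
      ∃ m, Nat.card V = k + m + 1 ∧ k + 1 ≤ G.universalVerts.ncard + m := by
  refine h.iso_induction (P := fun {V} G => (Nat.card V = k ∧ G = ⊤) ∨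
      ∃ m, Nat.card V = k + m + 1 ∧ k + 1 ≤ G.universalVerts.ncard + m) ?_ ?_ ?_
  · intro V W G H e h
    rcases h with ⟨h, rfl⟩ | ⟨m, h, hm⟩
    · exact .inl ⟨by rw [← h, Nat.card_congr e.toEquiv], eq_top_of_iso e⟩
    · refine .inr ⟨m, by rw [← h, Nat.card_congr e.toEquiv], ?_⟩
      have : H.universalVerts = e '' G.universalVerts := by
        ext w
        constructor
        · intro hw
          exact ⟨e.symm w, hw.map e.symm, by simp⟩
        · rintro ⟨x, hx, rfl⟩
          exact IsUniversal.map hx e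
      rwa [this, Set.ncard_image_of_injective _ e.injective]
  · exact .inl ⟨by simp, rfl⟩
  · intro V G C hG ih hC hk
    have hfin := hG.finite
    have hk' : C.ncard = k := by rw [Set.ncard, hk]; simp
    right
    rw [Finite.card_option]
    rcases ih with ⟨h, rfl⟩ | ⟨m, h, hm⟩
    -- The first attachment must use the whole complete graph, giving `k + 1` universal vertices:
    -- this is `m = 0`.
    · have hCu : C = Set.univ := by
        refine Set.eq_of_subset_of_ncard_le (Set.subset_univ _) ?_
        rw [Set.ncard_univ, h, hk']
      refine ⟨0, by rw [h], ?_⟩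
      have : ((⊤ : SimpleGraph V).attach C).universalVerts = Set.univ := by
        rw [Set.eq_univ_iff_forall]
        rintro (_ | u)
        · exact isUniversal_none_attach.2 (by simp [hCu])
        · exact isUniversal_some_attach.2 ⟨eq_top_iff_isUniversal.1 rfl u, by simp [hCu]⟩
      rw [this, Set.ncard_univ, Finite.card_option, h]
    · refine ⟨m + 1, by rw [h]; rfl, ?_⟩
      -- This union is a clique and `C` has `k` elements, so at most one universal vertex lies
      -- outside `C`; those inside stay universal.
      have h1 : (C ∪ G.universalVerts).ncard ≤ k + 1 := by
        have := hG.encard_clique_le _ hC.union_universalVerts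
        rw [← (Set.toFinite _).cast_ncard_eq] at this
        exact_mod_cast this
      have h2 := Set.ncard_union_add_ncard_inter C G.universalVerts
      have h3 : (some '' (C ∩ G.universalVerts)) ⊆ (G.attach C).universalVerts := by
        rintro _ ⟨u, hu, rfl⟩
        exact isUniversal_some_attach.2 ⟨hu.2, hu.1⟩
      have h4 := Set.ncard_le_ncard h3 (Set.toFinite _)
      rw [Set.ncard_image_of_injective _ (Option.some_injective V)] at h4
      omega

/-- A `(k + 1)`-tree on `2 * k + 4` vertices without universal vertices arises from a smaller graph
of this kind by adding a universal vertex, and then a vertex adjacent to a maximal clique of the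
smaller graph. -/
theorem exists_iso_attach_cone {V : Type} {G : SimpleGraph V} (h : IsKTree k G)
    (hV : Nat.card V = 2 * k + 2) (hG : ∀ v, ¬ G.IsUniversal v) :
    ∃ (W : Type) (H : SimpleGraph W) (C : Set W), Nat.card W = 2 * k ∧ IsKTree k H.cone ∧
      (∀ v, ¬ H.IsUniversal v) ∧ H.IsClique C ∧ C.encard = k ∧
      Nonempty (H.cone.attach (some '' C) ≃g G) := by
  have hfin : Finite V := h.finite
  cases h with
  | complete e =>
    rw [Nat.card_congr e.some] at hV
    simp at hV
    omega
  | adjoin G v smaller clique card =>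
    set G' := G.induce {w : V | w ≠ v} with hG'
    have hcard' : Nat.card {w : V | w ≠ v} = 2 * k + 1 := by
      have : ({w | w ≠ v} : Set V) = {v}ᶜ := rfl
      rw [this, Nat.card_coe_set_eq, Set.ncard_compl, hV, Set.ncard_singleton]
      rfl
    -- With `2 * k + 1` vertices the bound applies with `m = k` and leaves at least one universal
    -- vertex.
    obtain ⟨u, hu⟩ : ∃ u, G'.IsUniversal u := by
      rcases smaller.le_ncard_universalVerts with ⟨h1, h2⟩ | ⟨m, h1, h2⟩
      · have : Nonempty {w : V | w ≠ v} := (Nat.card_pos_iff.1 (by omega)).1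
        exact ⟨Classical.arbitrary _, eq_top_iff_isUniversal.1 h2 _⟩
      · have : 0 < G'.universalVerts.ncard := by omega
        exact Set.nonempty_of_ncard_ne_zero this.ne'
    have hnot : ∀ x, G'.IsUniversal x → ¬ G.Adj v x := by
      intro x hx hvx
      refine hG x fun w hw => ?_
      by_cases hwv : w = v
      · rw [hwv]; exact hvx.symm
      · exact hx (w := ⟨w, hwv⟩) fun h => hw (congrArg Subtype.val h)
    have hcone : IsKTree k (G'.induce {w | w ≠ u}).cone := by
      refine smaller.of_iso ((attachInduce G' u).symm.trans (attachCongr Iso.refl ?_))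
      rintro ⟨x, hx⟩
      simpa using hu (Ne.symm hx)
    refine ⟨_, G'.induce {w | w ≠ u}, {w | G.Adj v w.1.1}, ?_, hcone, ?_, ?_, ?_, ⟨?_⟩⟩
    · have : ({w | w ≠ u} : Set {w : V | w ≠ v}) = {u}ᶜ := rfl
      rw [this, Nat.card_coe_set_eq, Set.ncard_compl, hcard', Set.ncard_singleton]
      rfl
    -- A second universal vertex `x` of `G'` would, like `u`, lie outside the neighbourhood `C` of
    -- `v`, and `C ∪ {x, u}` would be a clique of size `k + 2`.
    · rintro ⟨x, hxu⟩ hx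
      have hx' : G'.IsUniversal x := by
        intro w hw
        by_cases hwu : w = u
        · subst hwu
          exact (hu (Ne.symm hw)).symm
        · exact hx (w := ⟨w, hwu⟩) fun h => hw (congrArg Subtype.val h)
      let C : Set {w : V | w ≠ v} := {w | G.Adj v w}
      have hC : G'.IsClique C := fun a ha b hb hab =>
        clique ha hb fun h => hab (Subtype.ext h)
      have hCk : C.encard = k := by
        rw [← card, ← Subtype.val_injective.encard_image]
        congr 1
        ext w
        simp only [Set.mem_image, mem_neighborSet]
        exact ⟨by rintro ⟨x, hx, rfl⟩; exact hx, fun h => ⟨⟨w, h.ne'⟩, h, rfl⟩⟩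
      have h1 := smaller.encard_clique_le _ hC.union_universalVerts
      have h2 : C ∪ {x, u} ⊆ C ∪ G'.universalVerts := by
        apply Set.union_subset_union_right
        rintro y (rfl | rfl)
        · exact hx'
        · exact hu
      have h3 := (Set.encard_le_encard h2).trans h1
      rw [Set.encard_union_eq, hCk, Set.encard_pair hxu] at h3
      · have h4 : k + 2 ≤ k + 1 := by exact_mod_cast h3
        omega
      · rw [Set.disjoint_left]
        rintro y hy (rfl | rfl)
        · exact hnot _ hx' hy
        · exact hnot _ hu hy
    · intro a ha b hb hab
      exact clique ha hb fun h => hab (Subtype.ext (Subtype.ext h))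
    · rw [← card, ← (Subtype.val_injective.comp Subtype.val_injective).encard_image]
      congr 1
      ext w
      simp only [Set.mem_image, mem_neighborSet, Function.comp]
      constructor
      · rintro ⟨x, hx, rfl⟩
        exact hx
      · intro h
        refine ⟨⟨⟨w, h.ne'⟩, ?_⟩, h, rfl⟩
        rintro rfl
        exact hnot _ hu h
    · refine (attachCongr (D := {w : {w : V | w ≠ v} | G.Adj v w.1})
        ((attachCongr Iso.refl ?_).trans (attachInduce G' u)) ?_).trans (attachInduce G v)
      · rintro ⟨x, hx⟩
        simpa using hu (Ne.symm hx)
      · rintro (_ | x)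
        · exact iff_of_false (by simp) (hnot _ hu)
        · exact (Option.some_injective _).mem_set_image

end IsKTree

/-! ### Halves of a tree and their intersection graph. -/

namespace SimpleGraph

variable {A B V W : Type*} {T : SimpleGraph A} {T' : SimpleGraph B} {G : SimpleGraph V}
  {H : SimpleGraph W} {h : V → A → Prop} {k : ℕ}

/-- Exactly one edge joins a vertex satisfying `S` to a vertex not satisfying `S`. -/
def IsHalf (T : SimpleGraph A) (S : A → Prop) : Prop :=
  ∃ a b, (S a ∧ ¬ S b ∧ T.Adj a b) ∧ ∀ a' b', S a' → ¬ S b' → T.Adj a' b' → a' = a ∧ b' = b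

/-- `G` is the intersection graph of the halves of the tree `T`, where `h v` is the half that
corresponds to the vertex `v`. -/
structure IsHalfGraph (k : ℕ) (T : SimpleGraph A) (G : SimpleGraph V) (h : V → A → Prop) :
    Prop where
  tree : IsKTree 1 T
  card_tree : Nat.card A = k + 1
  card : Nat.card V = 2 * k
  -- Stating this for the cone lets the induction start at the one-vertex tree, where `k = 0` and
  -- `G` is empty.
  cone : IsKTree k G.cone
  not_isUniversal : ∀ v, ¬ G.IsUniversal v
  injective : ∀ v w, (∀ a, h v a ↔ h w a) → v = w
  isHalf_iff : ∀ S : A → Prop, T.IsHalf S ↔ ∃ v, ∀ a, S a ↔ h v a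
  adj_iff : ∀ v w, G.Adj v w ↔ v ≠ w ∧ ∃ a, h v a ∧ h w a
  helly : ∀ s, G.IsClique s → ∃ a, ∀ v ∈ s, h v a
  encard_star : ∀ a, {v | h v a}.encard = k
  separates : ∀ a b, (∀ v, h v a → h v b) → a = b
  tree_adj_iff : ∀ a b, T.Adj a b ↔ ∃! v, h v a ∧ ¬ h v b

theorem IsHalf.map {S : A → Prop} (hS : T.IsHalf S) (e : T' ≃g T) :
    T'.IsHalf fun b => S (e b) := by
  obtain ⟨a, b, ⟨h1, h2, h3⟩, h4⟩ := hS
  refine ⟨e.symm a, e.symm b, ⟨by simpa, by simpa, e.symm.map_adj_iff.2 h3⟩, ?_⟩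
  intro a' b' ha hb hab
  obtain ⟨rfl, rfl⟩ := h4 _ _ ha hb (e.map_adj_iff.2 hab)
  simp

theorem eq_of_forall_adj (hT : T.Preconnected) {S : A → Prop}
    (hS : ∀ a b, T.Adj a b → S a → S b) {a b : A} (ha : S a) : S b := by
  obtain ⟨p⟩ := hT a b
  induction p with
  | nil => exact ha
  | cons hadj _ ih => exact ih (hS _ _ hadj ha)

/-- The extension of a family of halves of `T` to the tree obtained by adding a leaf at `c`. -/
def extendHalves (h : V → A → Prop) (c : A) : Option (Option V) → Option A → Prop
  | none, x => x = none
  | some none, x => x ≠ none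
  | some (some w), x => h w (x.getD c)

/-- If `S` separates the leaf from `c`, that edge is the only crossing one, so `S` is constant on
the connected graph `T`. Otherwise the new edge does not cross and `S` is governed by its
restriction to `T`. -/
theorem isHalf_attach_iff (hT : T.Preconnected) (c : A) (S : Option A → Prop) :
    (T.attach {c}).IsHalf S ↔ (∀ x, S x ↔ x = none) ∨ (∀ x, S x ↔ x ≠ none) ∨
      (S none ↔ S (some c)) ∧ T.IsHalf fun a => S (some a) := by
  by_cases hc : S none ↔ S (some c)
  · have h1 : ¬ ∀ x, S x ↔ x = none := fun h => by
      have := h none; have := h (some c); simp_all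
    have h2 : ¬ ∀ x, S x ↔ x ≠ none := fun h => by
      have := h none; have := h (some c); simp_all
    simp only [h1, h2, hc, true_and, false_or]
    constructor
    · rintro ⟨a | a, b | b, ⟨ha, hb, hab⟩, h⟩
      · exact absurd ha hb
      · obtain rfl : b = c := by simpa using hab
        exact absurd (hc.1 ha) hb
      · obtain rfl : a = c := by simpa using hab
        exact absurd (hc.2 ha) hb
      · exact ⟨a, b, ⟨ha, hb, hab⟩, fun a' b' ha' hb' hab' => by
          simpa using h (some a') (some b') ha' hb' hab'⟩
    · rintro ⟨a, b, ⟨ha, hb, hab⟩, h⟩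
      refine ⟨some a, some b, ⟨ha, hb, hab⟩, ?_⟩
      rintro (_ | a') (_ | b') ha' hb' hab'
      · exact absurd ha' hb'
      · obtain rfl : b' = c := by simpa using hab'
        exact absurd (hc.1 ha') hb'
      · obtain rfl : a' = c := by simpa using hab'
        exact absurd (hc.2 ha') hb'
      · obtain ⟨rfl, rfl⟩ := h a' b' ha' hb' hab'
        exact ⟨rfl, rfl⟩
  · simp only [hc, false_and, or_false]
    by_cases hn : S none
    · have hsc : ¬ S (some c) := fun h => hc (iff_of_true hn h)
      have h2 : ¬ ∀ x, S x ↔ x ≠ none := fun h => (h none).1 hn rfl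
      simp only [h2, or_false]
      constructor
      · rintro ⟨a, b, -, h⟩ (_ | x)
        · simp [hn]
        · simp only [reduceCtorEq, iff_false]
          intro hx
          obtain ⟨rfl, rfl⟩ := h none (some c) hn hsc rfl
          refine hsc (eq_of_forall_adj hT (S := fun a => S (some a)) ?_ hx)
          intro a' b' hab ha'
          by_contra hb'
          simpa using (h (some a') (some b') ha' hb' hab).1
      · intro h
        refine ⟨none, some c, ⟨hn, hsc, rfl⟩, ?_⟩
        rintro a' (_ | b') ha' hb' hab'
        · exact absurd hn hb'
        · obtain rfl := (h _).1 ha'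
          exact ⟨rfl, by simpa using hab'⟩
    · have hsc : S (some c) := by
        by_contra h
        exact hc (iff_of_false hn h)
      have h2 : ¬ ∀ x, S x ↔ x = none := fun h => hn ((h none).2 rfl)
      simp only [h2, false_or]
      constructor
      · rintro ⟨a, b, -, h⟩ (_ | x)
        · simp [hn]
        · simp only [ne_eq, reduceCtorEq, not_false_eq_true, iff_true]
          obtain ⟨rfl, rfl⟩ := h (some c) none hsc hn rfl
          refine eq_of_forall_adj hT (S := fun a => S (some a)) ?_ hsc
          intro a' b' hab ha'
          by_contra hb'
          simpa using (h (some a') (some b') ha' hb' hab).2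
      · intro h
        refine ⟨some c, none, ⟨hsc, hn, rfl⟩, ?_⟩
        rintro (_ | a') b' ha' hb' hab'
        · exact absurd ha' hn
        · have : b' = none := by
            by_contra h'
            exact hb' ((h _).2 h')
          subst this
          exact ⟨by simpa using hab', rfl⟩

namespace IsHalfGraph

theorem exists_of_vertex (hG : IsHalfGraph k T G h) (v : V) : ∃ a b, h v a ∧ ¬ h v b := by
  obtain ⟨a, b, ⟨ha, hb, -⟩, -⟩ := (hG.isHalf_iff (h v)).2 ⟨v, fun _ => Iff.rfl⟩
  exact ⟨a, b, ha, hb⟩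

theorem isClique_star (hG : IsHalfGraph k T G h) (a : A) : G.IsClique {v | h v a} :=
  fun v hv w hw hvw => (hG.adj_iff v w).2 ⟨hvw, a, hv, hw⟩

/-- By `helly` the clique lies in the star of some tree vertex, which has the same finite size. -/
theorem eq_star (hG : IsHalfGraph k T G h) {s : Set V} (hs : G.IsClique s) (hk : s.encard = k) :
    ∃ a, s = {v | h v a} := by
  obtain ⟨a, ha⟩ := hG.helly s hs
  refine ⟨a, (Set.finite_of_encard_eq_coe hk).eq_of_subset_of_encard_le ha ?_⟩
  rw [hk, hG.encard_star]

theorem congr_left (hG : IsHalfGraph k T G h) (e : T' ≃g T) :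
    IsHalfGraph k T' G fun v b => h v (e b) where
  tree := hG.tree.of_iso e.symm
  card_tree := by rw [Nat.card_congr e.toEquiv, hG.card_tree]
  card := hG.card
  cone := hG.cone
  not_isUniversal := hG.not_isUniversal
  injective v w hvw := hG.injective v w fun a => by simpa using hvw (e.symm a)
  isHalf_iff S := by
    constructor
    · intro hS
      obtain ⟨v, hv⟩ := (hG.isHalf_iff _).1 (hS.map e.symm)
      exact ⟨v, fun a => by simpa using hv (e a)⟩
    · rintro ⟨v, hv⟩
      rw [show S = fun b => h v (e b) from funext fun b => propext (hv b)]
      exact ((hG.isHalf_iff (h v)).2 ⟨v, fun _ => Iff.rfl⟩).map e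
  adj_iff v w := by
    rw [hG.adj_iff, e.surjective.exists]
  helly s hs := by
    obtain ⟨a, ha⟩ := hG.helly s hs
    exact ⟨e.symm a, by simpa using ha⟩
  encard_star a := hG.encard_star (e a)
  separates a b hab := e.injective (hG.separates _ _ hab)
  tree_adj_iff a b := by rw [← e.map_adj_iff, hG.tree_adj_iff]

theorem congr_right (hG : IsHalfGraph k T G h) (e : H ≃g G) :
    IsHalfGraph k T H fun w a => h (e w) a where
  tree := hG.tree
  card_tree := hG.card_tree
  card := by rw [Nat.card_congr e.toEquiv, hG.card]
  cone := hG.cone.of_iso (coneCongr e.symm)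
  not_isUniversal v hv := hG.not_isUniversal _ (hv.map e)
  injective v w hvw := e.injective (hG.injective _ _ hvw)
  isHalf_iff S := by rw [hG.isHalf_iff, e.surjective.exists]
  adj_iff v w := by rw [← e.map_adj_iff, hG.adj_iff, e.injective.ne_iff]
  helly s hs := by
    obtain ⟨a, ha⟩ := hG.helly (e '' s) (by
      rintro _ ⟨x, hx, rfl⟩ _ ⟨y, hy, rfl⟩ hxy
      exact e.map_adj_iff.2 (hs hx hy fun h => hxy (by rw [h])))
    exact ⟨a, fun v hv => ha _ ⟨v, hv, rfl⟩⟩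
  encard_star a := by
    rw [← hG.encard_star a]
    exact Set.encard_preimage_of_bijective e.bijective {v | h v a}
  separates a b hab := hG.separates _ _ (e.surjective.forall.2 hab)
  tree_adj_iff a b := by
    rw [hG.tree_adj_iff, e.bijective.existsUnique_iff]

/-- The half graph of a tree is determined by the tree. -/
theorem nonempty_iso {h' : W → A → Prop} (hG : IsHalfGraph k T G h) (hH : IsHalfGraph k T H h') :
    Nonempty (G ≃g H) := by
  have h1 : ∀ v, ∃ w, ∀ a, h v a ↔ h' w a := fun v =>
    (hH.isHalf_iff (h v)).1 ((hG.isHalf_iff _).2 ⟨v, fun _ => Iff.rfl⟩)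
  have h2 : ∀ w, ∃ v, ∀ a, h' w a ↔ h v a := fun w =>
    (hG.isHalf_iff (h' w)).1 ((hH.isHalf_iff _).2 ⟨w, fun _ => Iff.rfl⟩)
  choose f hf using h1
  choose g hg using h2
  refine ⟨⟨⟨f, g, fun v => ?_, fun w => ?_⟩, ?_⟩⟩
  · exact hG.injective _ _ fun a => ((hf v a).trans (hg _ a)).symm
  · exact hH.injective _ _ fun a => ((hg w a).trans (hf _ a)).symm
  · intro v w
    have hne : f v ≠ f w ↔ v ≠ w := by
      refine not_congr ⟨fun h => hG.injective _ _ fun a => ?_, congrArg f⟩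
      rw [hf, hf, h]
    simp only [Equiv.coe_fn_mk, hH.adj_iff, hG.adj_iff, hne, hf]

/-- The tree is determined by its half graph. -/
theorem nonempty_iso_tree {h' : V → B → Prop} (hG : IsHalfGraph k T G h)
    (hH : IsHalfGraph k T' G h') : Nonempty (T ≃g T') := by
  -- Both trees have the `k`-cliques of the same graph as their stars, which matches their vertices;
  -- `tree_adj_iff` reads adjacency off the stars.
  have h1 : ∀ a, ∃ b, {v | h v a} = {v | h' v b} := fun a =>
    hH.eq_star (hG.isClique_star a) (hG.encard_star a)
  have h2 : ∀ b, ∃ a, {v | h' v b} = {v | h v a} := fun b =>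
    hG.eq_star (hH.isClique_star b) (hH.encard_star b)
  choose f hf using h1
  choose g hg using h2
  refine ⟨⟨⟨f, g, fun a => ?_, fun b => ?_⟩, ?_⟩⟩
  · exact hG.separates _ _ fun v hv => ((hf a).trans (hg _)).symm.subset hv
  · exact hH.separates _ _ fun v hv => ((hg b).trans (hf _)).symm.subset hv
  · intro a b
    have : ∀ a v, h' v (f a) ↔ h v a := fun a v => (Set.ext_iff.1 (hf a) v).symm
    simp only [Equiv.coe_fn_mk, hH.tree_adj_iff, hG.tree_adj_iff, this]

/-- A half graph for a tree with one vertex. -/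
theorem of_card_eq_one {A V : Type} (eA : Nonempty (A ≃ Fin 1)) [IsEmpty V] (G : SimpleGraph V) :
    IsHalfGraph 0 (⊤ : SimpleGraph A) G fun v _ => isEmptyElim v where
  tree := .complete eA
  card_tree := by rw [Nat.card_congr eA.some, Nat.card_fin]
  card := by simp
  cone := by
    have : G = ⊤ := by ext v; exact isEmptyElim v
    subst this
    exact (IsKTree.attach (.complete ⟨Equiv.equivOfIsEmpty _ _⟩) (fun v => isEmptyElim v)
      (by simp [Set.eq_empty_of_isEmpty]))
  not_isUniversal v := isEmptyElim v
  injective v := isEmptyElim v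
  isHalf_iff S := by
    have : Subsingleton A := eA.some.subsingleton
    constructor
    · rintro ⟨a, b, ⟨-, -, h⟩, -⟩
      exact absurd (Subsingleton.elim a b) h
    · rintro ⟨v, -⟩
      exact isEmptyElim v
  adj_iff v := isEmptyElim v
  helly s _ := ⟨eA.some.symm 0, fun v => isEmptyElim v⟩
  encard_star a := by simp [Set.eq_empty_of_isEmpty]
  separates a b _ := by
    have : Subsingleton A := eA.some.subsingleton
    exact Subsingleton.elim a b
  tree_adj_iff a b := by
    have : Subsingleton A := eA.some.subsingleton
    simp [Subsingleton.elim a b]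

theorem attach {A V : Type} {T : SimpleGraph A} {G : SimpleGraph V} {h : V → A → Prop}
    (hG : IsHalfGraph k T G h) (hT : T.Preconnected) (c : A) :
    IsHalfGraph (k + 1) (T.attach {c}) (G.cone.attach (some '' {v | h v c}))
      (extendHalves h c) where
  tree := hG.tree.attach (by simp) (by simp)
  card_tree := by
    have := hG.tree.finite
    rw [Finite.card_option, hG.card_tree]
  card := by
    have : Finite V := 
      have := hG.cone.finite
      Finite.of_injective some (Option.some_injective V)
    rw [Finite.card_option, Finite.card_option, hG.card]
    ring
  cone := by
    refine (hG.cone.attach ?_ ?_).cone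
    · rintro _ ⟨a, ha, rfl⟩ _ ⟨b, hb, rfl⟩ hab
      exact hG.isClique_star c ha hb fun h => hab (by rw [h])
    · rw [(Option.some_injective V).encard_image, hG.encard_star]
  not_isUniversal := by
    rintro (_ | _ | v) hv
    · simpa using isUniversal_none_attach.1 hv none
    · simpa using (isUniversal_some_attach.1 hv).2
    · exact hG.not_isUniversal v
        (isUniversal_some_attach.1 (isUniversal_some_attach.1 hv).1).1
  injective := by
    have h1 : ∀ v, ¬ ∀ x, extendHalves h c none x ↔ extendHalves h c (some (some v)) x := by
      intro v hv
      have h1 := hv none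
      have h2 := hv (some c)
      simp [extendHalves] at h1 h2
      exact absurd h1 h2
    have h2 : ∀ v, ¬ ∀ x, extendHalves h c (some none) x ↔ extendHalves h c (some (some v)) x := by
      intro v hv
      have h1 := hv none
      have h2 := hv (some c)
      simp [extendHalves] at h1 h2
      exact h1 h2
    rintro (_ | _ | v) (_ | _ | w) hvw
    · rfl
    · simpa [extendHalves] using hvw none
    · exact absurd hvw (h1 w)
    · simpa [extendHalves] using hvw none
    · rfl
    · exact absurd hvw (h2 w)
    · exact absurd (fun x => (hvw x).symm) (h1 v)
    · exact absurd (fun x => (hvw x).symm) (h2 v)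
    · rw [hG.injective v w fun a => hvw (some a)]
  isHalf_iff S := by
    rw [isHalf_attach_iff hT, Option.exists, Option.exists, hG.isHalf_iff]
    refine or_congr Iff.rfl (or_congr Iff.rfl ?_)
    constructor
    · rintro ⟨h1, v, hv⟩
      refine ⟨v, ?_⟩
      rintro (_ | a)
      · exact h1.trans (hv c)
      · exact hv a
    · rintro ⟨v, hv⟩
      exact ⟨(hv none).trans (hv (some c)).symm, v, fun a => hv (some a)⟩
  adj_iff := by
    have hne : ∀ v, ∃ a, h v a := fun v => (hG.exists_of_vertex v).imp fun a ⟨b, hb⟩ => hb.1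
    rintro (_ | _ | v) (_ | _ | w)
    · simp
    · simp [extendHalves, SimpleGraph.attach]
    · simp [extendHalves]
    · simp [extendHalves, SimpleGraph.attach]
    · simp
    · simpa [extendHalves, Option.exists] using hne w
    · simp [extendHalves]
    · simpa [extendHalves, Option.exists] using hne v
    · simp only [attach_some_some, hG.adj_iff, extendHalves, Option.exists, Option.getD_none,
        Option.getD_some, ne_eq, Option.some.injEq]
      refine and_congr_right fun _ => ⟨.inr, ?_⟩
      rintro (h | h)
      · exact ⟨c, h⟩
      · exact h
  helly s hs := by
    -- A clique containing the half `{leaf}` has only halves through the leaf. Otherwise a common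
    -- vertex of its old halves also lies in the complement of the leaf.
    by_cases h0 : none ∈ s
    · refine ⟨none, ?_⟩
      rintro (_ | _ | v) hv
      · rfl
      · simpa using hs h0 hv (by simp)
      · simpa [extendHalves] using hs h0 hv (by simp)
    · obtain ⟨a, ha⟩ := hG.helly {v | some (some v) ∈ s} fun v hv w hw hvw =>
        hs hv hw (by simpa using hvw)
      refine ⟨some a, ?_⟩
      rintro (_ | _ | v) hv
      · exact absurd hv h0
      · simp [extendHalves]
      · exact ha v hv
  encard_star := by
    rintro (_ | a)
    · rw [Set.encard_of_none_mem (by simp [extendHalves]),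
        Set.encard_of_none_notMem (by simp [extendHalves]), Nat.cast_add, ← hG.encard_star c]
      rfl
    · rw [Set.encard_of_none_notMem (by simp [extendHalves]),
        Set.encard_of_none_mem (by simp [extendHalves]), Nat.cast_add, ← hG.encard_star a]
      rfl
  separates := by
    rintro (_ | a) (_ | b) hab
    · rfl
    · simpa [extendHalves] using hab none
    · simpa [extendHalves] using hab (some none)
    · rw [hG.separates a b fun v => hab (some (some v))]
  tree_adj_iff := by
    -- For the leaf and an old vertex, exactly one new half `q` separates them in the given
    -- direction. Uniqueness thus means that no old half does, and `separates` identifies the old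
    -- vertex with `c`.
    have key : ∀ (p : Option (Option V) → Prop) (q : Option (Option V)), p q →
        (∀ v, q ≠ some (some v)) → (∀ w, q ≠ w → (∀ v, w ≠ some (some v)) → ¬ p w) →
        ((∃! w, p w) ↔ ∀ v, ¬ p (some (some v))) := by
      intro p q hq hqv hw
      constructor
      · rintro ⟨w, hw, huniq⟩ v hv
        exact hqv v ((huniq _ hq).trans (huniq _ hv).symm)
      · intro hv
        refine ⟨q, hq, fun w hpw => ?_⟩
        by_contra hne
        refine hw w (Ne.symm hne) ?_ hpw
        rintro v rfl
        exact hv v hpw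
    rintro (_ | a) (_ | b)
    · simp
    · rw [key _ none (by simp [extendHalves]) (by simp)
        (by rintro (_ | _ | v) <;> simp [extendHalves])]
      simp only [attach_none_some, Set.mem_singleton_iff, extendHalves, Option.getD_none,
        Option.getD_some, not_and_not_right]
      exact ⟨by rintro rfl; exact fun _ => id, fun h => (hG.separates _ _ h).symm⟩
    · rw [key _ (some none) (by simp [extendHalves]) (by simp)
        (by rintro (_ | _ | v) <;> simp [extendHalves])]
      simp only [attach_some_none, Set.mem_singleton_iff, extendHalves, Option.getD_none,
        Option.getD_some, not_and_not_right]
      exact ⟨by rintro rfl; exact fun _ => id, fun h => hG.separates _ _ h⟩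
    · rw [attach_some_some, hG.tree_adj_iff]
      constructor
      · rintro ⟨v, hv, huniq⟩
        refine ⟨some (some v), hv, ?_⟩
        rintro (_ | _ | w) hw
        · simp [extendHalves] at hw
        · simp [extendHalves] at hw
        · rw [huniq w hw]
      · rintro ⟨_ | _ | v, hv, huniq⟩
        · simp [extendHalves] at hv
        · simp [extendHalves] at hv
        · exact ⟨v, hv, fun w hw => by simpa using huniq (some (some w)) hw⟩

end IsHalfGraph

end SimpleGraph

/-! ### Ordinary trees as `1`-trees, and existence of the correspondence. -/

open SimpleGraph

theorem SimpleGraph.IsTree.attach_singleton {V : Type*} [Finite V] {T : SimpleGraph V}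
    (hT : T.IsTree) (c : V) : (T.attach {c}).IsTree := by
  obtain ⟨hconn, hcard⟩ := isTree_iff_connected_and_card.1 hT
  refine isTree_iff_connected_and_card.2 ⟨?_, ?_⟩
  · have hc : ∀ a, (T.attach {c}).Reachable (some c) a := by
      rintro (_ | a)
      · exact Adj.reachable (by simp)
      · exact (hconn.preconnected c a).map (G' := T.attach {c}) ⟨some, fun h => h⟩
    exact ⟨fun a b => (hc a).symm.trans (hc b)⟩
  · have : (T.attach {c}).edgeSet = insert s(none, some c) (Sym2.map some '' T.edgeSet) := by
      ext e
      induction e with | _ a b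
      rcases a with _ | a <;> rcases b with _ | b
      · simp [Sym2.exists]
      · simp [Sym2.exists]
      · simp [Sym2.exists]
      · rw [Set.mem_insert_iff, ← Sym2.map_mk,
          (Sym2.map.injective (Option.some_injective V)).mem_set_image]
        simp
    rw [this, Nat.card_coe_set_eq, Set.ncard_insert_of_notMem,
      Set.ncard_image_of_injective _ (Sym2.map.injective (Option.some_injective V)),
      Finite.card_option, ← hcard, Nat.card_coe_set_eq]
    rintro ⟨e, -, he⟩
    have : none ∈ Sym2.map some e := by simp [he]
    simp at this

theorem isKTree_one_iff_isTree {V : Type} [Finite V] {T : SimpleGraph V} :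
    IsKTree 1 T ↔ T.IsTree := by
  constructor
  · intro h
    refine h.iso_induction (P := fun {V} T => T.IsTree) ?_ ?_ ?_
    · exact fun e h => e.isTree_iff.1 h
    · exact IsTree.of_subsingleton
    · intro V T C hT ih _ hC
      obtain ⟨c, rfl⟩ := Set.encard_eq_one.1 hC
      have := hT.finite
      exact ih.attach_singleton c
  · generalize hn : Nat.card V = n
    induction n generalizing V with
    | zero =>
      intro h
      have := h.1.nonempty
      have := Nat.card_pos (α := V)
      omega
    | succ n ih =>
      intro h
      classical
      have := Fintype.ofFinite V
      rcases n.eq_zero_or_pos with rfl | hpos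
      · obtain ⟨hs, -⟩ := Nat.card_eq_one_iff_unique.1 hn
        have : T = ⊤ := by ext a b; simp [Subsingleton.elim a b]
        subst this
        exact .complete ⟨Finite.equivFinOfCardEq hn⟩
      · have : Nontrivial V := Finite.one_lt_card_iff_nontrivial.1 (by omega)
        obtain ⟨v, hv⟩ := h.exists_vert_degree_one_of_nontrivial
        have hT : (T.induce {w | w ≠ v}).IsTree :=
          ⟨h.1.induce_compl_singleton_of_degree_eq_one hv, h.2.induce _⟩
        obtain ⟨c, hc, huniq⟩ := degree_eq_one_iff_existsUnique_adj.1 hv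
        have hN : T.neighborSet v = {c} := by
          ext w
          exact ⟨huniq w, by rintro rfl; exact hc⟩
        refine .adjoin T v (ih ?_ hT) (by simp [hN]) (by simp [hN])
        have : ({w | w ≠ v} : Set V) = {v}ᶜ := rfl
        rw [this, Nat.card_coe_set_eq, Set.ncard_compl, hn, Set.ncard_singleton]
        rfl

theorem IsKTree.preconnected {V : Type} {T : SimpleGraph V} (h : IsKTree 1 T) :
    T.Preconnected := by
  have := h.finite
  exact (isKTree_one_iff_isTree.1 h).1.preconnected

/-- Every tree has a half graph. -/
theorem IsKTree.exists_isHalfGraph {A : Type} {T : SimpleGraph A} (hT : IsKTree 1 T) :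
    ∃ (k : ℕ) (V : Type) (G : SimpleGraph V) (h : V → A → Prop), IsHalfGraph k T G h := by
  refine hT.iso_induction (P := fun {A} T => ∃ (k : ℕ) (V : Type) (G : SimpleGraph V)
    (h : V → A → Prop), IsHalfGraph k T G h) ?_ ?_ ?_
  · rintro A B T T' e ⟨k, V, G, h, hG⟩
    exact ⟨k, V, G, _, hG.congr_left e.symm⟩
  · exact ⟨0, Empty, ⊥, _, IsHalfGraph.of_card_eq_one ⟨Equiv.refl _⟩ ⊥⟩
  · rintro A T C hT ⟨k, V, G, h, hG⟩ _ hC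
    obtain ⟨c, rfl⟩ := Set.encard_eq_one.1 hC
    exact ⟨k + 1, _, _, _, hG.attach hT.preconnected c⟩

/-- Every graph on `2 * k` vertices without universal vertices whose cone is a `k`-tree is the half
graph of a tree. -/
theorem IsKTree.exists_isHalfGraph_of_cone {k : ℕ} {V : Type} {G : SimpleGraph V}
    (hG : IsKTree k G.cone) (hV : Nat.card V = 2 * k) (hu : ∀ v, ¬ G.IsUniversal v) :
    ∃ (A : Type) (T : SimpleGraph A) (h : V → A → Prop), IsHalfGraph k T G h := by
  induction k generalizing V with
  | zero =>
    have := hG.finite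
    have : Finite V := Finite.of_injective some (Option.some_injective V)
    have : IsEmpty V := Finite.card_eq_zero_iff.1 hV
    exact ⟨Fin 1, ⊤, _, IsHalfGraph.of_card_eq_one ⟨Equiv.refl _⟩ G⟩
  | succ k ih =>
    obtain ⟨W, H, C, hW, hH, hHu, hC, hk, ⟨e⟩⟩ :=
      (isKTree_cone_iff.1 hG).exists_iso_attach_cone hV hu
    obtain ⟨A, T, h, hT⟩ := ih hH hW hHu
    obtain ⟨c, rfl⟩ := hT.eq_star hC hk
    exact ⟨_, _, _, (hT.attach hT.tree.preconnected c).congr_right e.symm⟩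

/-! ### Counting isomorphism classes. -/

/-- A relation suffices in place of a map: `hR` makes arbitrary choices of partners well defined and
mutually inverse on classes. -/
theorem unlabeledCount_congr {m n : ℕ} {P : SimpleGraph (Fin m) → Prop}
    {Q : SimpleGraph (Fin n) → Prop} (R : SimpleGraph (Fin m) → SimpleGraph (Fin n) → Prop)
    (hPQ : ∀ G, P G → ∃ H, Q H ∧ R G H) (hQP : ∀ H, Q H → ∃ G, P G ∧ R G H)
    (hR : ∀ G G' H H', R G H → R G' H' → (Nonempty (G ≃g G') ↔ Nonempty (H ≃g H'))) :
    unlabeledCount m P = unlabeledCount n Q := by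
  choose f hf hfR using hPQ
  choose g hg hgR using hQP
  refine Nat.card_congr
    ⟨Quotient.map (fun G => ⟨f G.1 G.2, hf _ _⟩) fun G G' h => ?_,
      Quotient.map (fun H => ⟨g H.1 H.2, hg _ _⟩) fun H H' h => ?_, ?_, ?_⟩
  · exact (hR _ _ _ _ (hfR _ _) (hfR _ _)).1 h
  · exact (hR _ _ _ _ (hgR _ _) (hgR _ _)).2 h
  · rintro ⟨G⟩
    exact Quotient.sound ((hR _ _ _ _ (hgR _ _) (hfR _ _)).2 ⟨Iso.refl⟩)
  · rintro ⟨H⟩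
    exact Quotient.sound ((hR _ _ _ _ (hfR _ _) (hgR _ _)).1 ⟨Iso.refl⟩)

theorem unlabeledCount_eq_add {m : ℕ} (P U : SimpleGraph (Fin m) → Prop)
    (hU : ∀ G H, Nonempty (G ≃g H) → U G → U H) :
    unlabeledCount m P =
      unlabeledCount m (fun G => P G ∧ U G) + unlabeledCount m (fun G => P G ∧ ¬ U G) := by
  rw [unlabeledCount, unlabeledCount, unlabeledCount, ← Nat.card_sum]
  symm
  let f : Quotient (graphIsoSetoid fun G : SimpleGraph (Fin m) => P G ∧ U G) →
      Quotient (graphIsoSetoid P) :=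
    Quotient.map (fun G => ⟨G.1, G.2.1⟩) fun _ _ h => h
  let g : Quotient (graphIsoSetoid fun G : SimpleGraph (Fin m) => P G ∧ ¬ U G) →
      Quotient (graphIsoSetoid P) :=
    Quotient.map (fun G => ⟨G.1, G.2.1⟩) fun _ _ h => h
  refine Nat.card_congr (Equiv.ofBijective (Sum.elim f g) ⟨?_, ?_⟩)
  · rintro (G | G) (H | H) h <;>
      obtain ⟨G, rfl⟩ := Quotient.exists_rep G <;> obtain ⟨H, rfl⟩ := Quotient.exists_rep H
    · exact congrArg Sum.inl (Quotient.sound (Quotient.exact h :))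
    · exact absurd (hU _ _ (Quotient.exact h :) G.2.2) H.2.2
    · exact absurd (hU _ _ (Quotient.exact h.symm :) H.2.2) G.2.2
    · exact congrArg Sum.inr (Quotient.sound (Quotient.exact h :))
  · rintro ⟨G⟩
    by_cases h : U G.1
    · exact ⟨.inl (Quotient.mk _ ⟨G.1, G.2, h⟩), rfl⟩
    · exact ⟨.inr (Quotient.mk _ ⟨G.1, G.2, h⟩), rfl⟩

theorem exists_fin_iso {V : Type} {n : ℕ} (hV : Nat.card V = n) (hn : n ≠ 0)
    (G : SimpleGraph V) : ∃ H : SimpleGraph (Fin n), Nonempty (H ≃g G) := by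
  -- `Nat.card` is `0` on infinite types, so `n ≠ 0` is what gives finiteness.
  have : Finite V := Nat.finite_of_card_ne_zero (by omega)
  exact ⟨_, ⟨Iso.comap (Finite.equivFinOfCardEq hV).symm G⟩⟩

/-- The `(k + 1)`-trees with a universal vertex are the cones over `k`-trees. -/
theorem unlabeledCount_isUniversal (m k : ℕ) :
    unlabeledCount (m + 1) (fun G => IsKTree (k + 1) G ∧ ∃ v, G.IsUniversal v) =
      unlabeledCount m fun G => IsKTree k G := by
  symm
  refine unlabeledCount_congr (fun G H => Nonempty (G.cone ≃g H)) ?_ ?_ ?_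
  · intro G hG
    obtain ⟨H, ⟨e⟩⟩ := exists_fin_iso (n := m + 1) (by simp) (by simp) G.cone
    exact ⟨H, ⟨hG.cone.of_iso e.symm, _, G.isUniversal_none_cone.map e.symm⟩, ⟨e.symm⟩⟩
  · rintro H ⟨hH, v, hv⟩
    have e : (H.induce {w | w ≠ v}).cone ≃g H := by
      refine (attachCongr Iso.refl ?_).trans (attachInduce H v)
      rintro ⟨x, hx⟩
      simpa using hv (Ne.symm hx)
    have hG := isKTree_cone_iff.1 (hH.of_iso e.symm)
    let e' : {w : Fin (m + 1) | w ≠ v} ≃ Fin m := (finSuccAboveEquiv v).symm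
    refine ⟨_, hG.of_iso (Iso.comap e'.symm _).symm, ⟨(coneCongr (Iso.comap e'.symm _)).trans e⟩⟩
  · rintro G G' H H' ⟨e⟩ ⟨e'⟩
    constructor
    · rintro ⟨f⟩
      exact ⟨(e.symm.trans (coneCongr f)).trans e'⟩
    · rintro ⟨f⟩
      exact nonempty_iso_of_cone ((e.trans f).trans e'.symm)

/-- The `k`-trees on `2 * k + 2` vertices without universal vertices correspond to trees. -/
theorem unlabeledCount_not_isUniversal (k : ℕ) :
    unlabeledCount (2 * (k + 1)) (fun G => IsKTree k G ∧ ¬ ∃ v, G.IsUniversal v) =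
      unlabeledCount (k + 2) fun T => IsKTree 1 T := by
  refine unlabeledCount_congr (fun G T => ∃ h, IsHalfGraph (k + 1) T G h) ?_ ?_ ?_
  · rintro G ⟨hG, hu⟩
    obtain ⟨A, T, h, hT⟩ := hG.cone.exists_isHalfGraph_of_cone (by simp) (not_exists.1 hu)
    obtain ⟨T', ⟨e⟩⟩ := exists_fin_iso (n := k + 2) hT.card_tree (by simp) T
    exact ⟨T', hT.tree.of_iso e.symm, _, hT.congr_left e⟩
  · intro T hT
    obtain ⟨j, V, G, h, hG⟩ := hT.exists_isHalfGraph
    obtain rfl : j = k + 1 := by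
      have := hG.card_tree
      rw [Nat.card_fin] at this
      omega
    obtain ⟨H, ⟨e⟩⟩ := exists_fin_iso hG.card (by simp) G
    have hH := hG.congr_right e
    exact ⟨H, ⟨isKTree_cone_iff.1 hH.cone, not_exists.2 hH.not_isUniversal⟩, _, hH⟩
  · rintro G G' T T' ⟨h, hG⟩ ⟨h', hG'⟩
    constructor
    · rintro ⟨e⟩
      exact hG.nonempty_iso_tree (hG'.congr_right e)
    · rintro ⟨e⟩
      exact hG.nonempty_iso (hG'.congr_left e)

theorem mainTheorem3 (n : ℕ) (hn : 4 ≤ n) :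
    (kTreeCount n (n - 2) : ℤ) - (kTreeCount n (n - 3) : ℤ) = (kTreeCount (n - 1) 1 : ℤ) ∧
      kTreeCount (n - 1) 1 = treeCount n := by
  -- With `n = m + 4` the truncated subtractions become `m + 2`, `m + 1` and `m + 3`.
  obtain ⟨m, rfl⟩ := Nat.exists_eq_add_of_le' hn
  constructor
  · have h1 : kTreeCount (m + 4) (m + 2) =
        unlabeledCount (2 * (m + 2 + 1)) fun G => IsKTree (m + 2) G := by
      rw [kTreeCount, show m + 4 + (m + 2) = 2 * (m + 2 + 1) by ring]
    have h2 : kTreeCount (m + 4) (m + 1) =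
        unlabeledCount (2 * (m + 2 + 1)) fun G => IsKTree (m + 2) G ∧ ∃ v, G.IsUniversal v := by
      rw [kTreeCount, ← unlabeledCount_isUniversal,
        show m + 4 + (m + 1) + 1 = 2 * (m + 2 + 1) by ring]
    have h3 := unlabeledCount_eq_add (m := 2 * (m + 2 + 1)) (fun G => IsKTree (m + 2) G)
      (fun G => ∃ v, G.IsUniversal v) fun G H ⟨e⟩ ⟨v, hv⟩ => ⟨_, hv.map e⟩
    rw [unlabeledCount_not_isUniversal, ← h1, ← h2] at h3
    change (kTreeCount (m + 4) (m + 2) : ℤ) - (kTreeCount (m + 4) (m + 1) : ℤ) =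
      (unlabeledCount (m + 2 + 2) fun T => IsKTree 1 T : ℕ)
    omega
  · change unlabeledCount (m + 4) (fun T => IsKTree 1 T) = treeCount (m + 4)
    simp only [isKTree_one_iff_isTree, treeCount]
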